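/- An effect algebra $(E;\oplus,0,1)$ is a set with a partial binary operation $\oplus$ that is commutative and associative (one side is defined iff the other is, and then they agree), in which every $a$ has a unique $a'$ with $a\oplus a'=1$, and in which $1\oplus a$ is defined only for $a=0$. It is ordered by $a\le b$ iff $a\oplus c=b$ for some $c$, and it is a lattice effect algebra if this order is a lattice. It is Archimedean if no nonzero $e$ has all multiples $ne=e\oplus\cdots\oplus e$ defined, and atomic if every nonzero element lies above an atom. Write $\mathrm{ord}(a)=n_a$ for the greatest $n$ such that $na$ is defined. Let $S(E)=\{x\in E: x\wedge x'=0\}$ be the set of sharp elements, an effect algebra under the inherited operation when $E$ is a lattice effect algebra. $E$ is sharply dominating if every $a\in E$ has a smallest sharp element above it. A state on an effect algebra $F$ is a map $\omega:F\to[0,1]$ with $\omega(1)=1$ and $\omega(x\oplus y)=\omega(x)+\omega(y)$ whenever $x\oplus y$ is defined. It is order-continuous if $\omega(x_\alpha)\to\omega(x)$ for every net $(x_\alpha)$ in $F$ that order converges to $x$, i.e. for which there are nets $u_\alpha\le x_\alpha\le v_\alpha$ over the same directed set, with $u_\alpha$ increasing with supremum $x$ and $v_\alpha$ decreasing with infimum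 $x$. A family is $\oplus$-orthogonal if all its finite subfamilies have a sum; its sum $\bigoplus$ is then the supremum of the finite sums, if this exists. A basic decomposition of $x\in E$ is an expression $x=v\oplus\bigoplus\{k_\alpha a_\alpha:\alpha\in\Lambda\}$ with $v\in S(E)$, distinct atoms $a_\alpha$ and positive integers $k_\alpha\ne\mathrm{ord}(a_\alpha)$ ($\Lambda$ may be empty). **Theorem 4.2 (state smearing theorem).** Let $E$ be a sharply dominating Archimedean atomic lattice effect algebra, and let $\omega$ be an order-continuous state on $S(E)$. Then every $x\in E$ has exactly one basic decomposition, and there is a state $\hat\omega$ on $E$ such that 1. $\hat\omega(x)=\omega(x)$ for all $x\in S(E)$; 2. for every atom $a$ of $E$, $n_a=\mathrm{ord}(a)$ is finite and positive, $n_a a\in S(E)$, and $\hat\omega(a)=\omega(n_a a)/n_a$; 3. for every $x\in E$ with basic decomposition $x=v\oplus\bigoplus\{k_\alpha a_\alpha:\alpha\in\Lambda\}$, $$\hat\omega(x)=\omega(v)+\sup\Big\{\sum_{\alpha\in K}k_\alpha\hat\omega(a_\alpha): K\subseteq\Lambda\text{ finite}\Big\}.$$ -/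

import Mathlib

universe u v

/-- An effect algebra `(E; ⊕, 0, 1)`. The partial operation is `oplus`, with `oplus a b = none`
when `a ⊕ b` is undefined. The order is the one induced by `⊕` (field `le_iff`). -/
class EffectAlgebra (E : Type u) extends Zero E, One E, PartialOrder E where
  oplus : E → E → Option E
  oplus_comm : ∀ a b, oplus a b = oplus b a
  /-- Both sides are defined or undefined together, and agree when defined. -/
  oplus_assoc : ∀ a b c,
    ((oplus a b).bind fun d => oplus d c) = (oplus b c).bind fun d => oplus a d
  existsUnique_orth : ∀ a, ∃! b, oplus a b = some 1
  eq_zero_of_one_oplus : ∀ a c, oplus 1 a = some c → a = 0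
  le_iff : ∀ a b, a ≤ b ↔ ∃ c, oplus a c = some b

/-- A lattice effect algebra: the induced order is a lattice. -/
class LatticeEffectAlgebra (E : Type u) extends EffectAlgebra E, Lattice E

namespace EffectAlgebra

section Basic

variable {E : Type u} [EffectAlgebra E]

/-- The orthosupplement `a'`, the unique element with `a ⊕ a' = 1`. -/
noncomputable def orth (a : E) : E := (existsUnique_orth a).choose

theorem oplus_orth (a : E) : oplus a (orth a) = some 1 :=
  (existsUnique_orth a).choose_spec.1

theorem eq_orth {a b : E} (h : oplus a b = some 1) : b = orth a :=
  (existsUnique_orth a).choose_spec.2 b h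

theorem orth_orth (a : E) : orth (orth a) = a :=
  (eq_orth (by rw [oplus_comm]; exact oplus_orth a)).symm

theorem assoc_right {a b c d e : E} (h : oplus a b = some d) (h' : oplus d c = some e) :
    ∃ f, oplus b c = some f ∧ oplus a f = some e := by
  have := oplus_assoc a b c
  rw [h, Option.bind_some, h'] at this
  exact Option.bind_eq_some_iff.1 this.symm

theorem assoc_left {a b c e f : E} (h : oplus b c = some f) (h' : oplus a f = some e) :
    ∃ d, oplus a b = some d ∧ oplus d c = some e := by
  have := oplus_assoc a b c
  rw [h, Option.bind_some, h'] at this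
  exact Option.bind_eq_some_iff.1 this

theorem one_oplus_zero : oplus (1 : E) 0 = some 1 := by
  have h := oplus_orth (1 : E)
  rwa [eq_zero_of_one_oplus _ _ h] at h

theorem oplus_zero (a : E) : oplus a 0 = some a := by
  have h : oplus (orth a) a = some 1 := by rw [oplus_comm]; exact oplus_orth a
  obtain ⟨f, hf, hf'⟩ := assoc_right h one_oplus_zero
  rw [hf, eq_orth hf', orth_orth]

theorem zero_oplus (a : E) : oplus 0 a = some a := by rw [oplus_comm, oplus_zero]

theorem oplus_left_cancel {a b c d : E} (h : oplus a b = some d) (h' : oplus a c = some d) :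
    b = c := by
  have key : ∀ x : E, oplus a x = some d → ∃ f, oplus (orth d) a = some f ∧ x = orth f := by
    intro x hx
    have h1 : oplus (orth d) d = some 1 := by rw [oplus_comm]; exact oplus_orth d
    obtain ⟨f, hf, hf'⟩ := assoc_left hx h1
    exact ⟨f, hf, eq_orth hf'⟩
  obtain ⟨f, hf, rfl⟩ := key b h
  obtain ⟨g, hg, rfl⟩ := key c h'
  rw [hf, Option.some.injEq] at hg
  rw [hg]

instance : BoundedOrder E where
  bot := 0
  bot_le a := (le_iff _ _).2 ⟨a, zero_oplus a⟩
  top := 1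
  le_top a := (le_iff _ _).2 ⟨orth a, oplus_orth a⟩

/-- `⊕` extended to possibly undefined arguments: a sum with an undefined term is undefined. -/
def padd (x y : Option E) : Option E := x.bind fun a => y.bind fun b => oplus a b

instance : Std.Commutative (padd (E := E)) where
  comm x y := by
    cases x <;> cases y <;> simp [padd, oplus_comm]

instance : Std.Associative (padd (E := E)) where
  assoc x y z := by
    cases x <;> cases y <;> cases z <;> simp [padd, oplus_assoc]

/-- The finite sum `⨁_{i ∈ s} f i` (`none` if undefined). -/
def oplusSum {ι : Type v} (f : ι → E) (s : Finset ι) : Option E :=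
  s.fold padd (some 0) fun i => some (f i)

/-- The multiple `n a = a ⊕ ⋯ ⊕ a` (`none` if undefined). -/
def mult : ℕ → E → Option E
  | 0, _ => some 0
  | n + 1, a => (mult n a).bind fun b => oplus b a

/-- The system `f` is `⊕`-orthogonal and `⨁ f` exists and equals `x`. -/
def HasBigSum {ι : Type v} (f : ι → E) (x : E) : Prop :=
  (∀ s : Finset ι, ∃ c, oplusSum f s = some c) ∧
    IsLUB {c | ∃ s : Finset ι, oplusSum f s = some c} x

/-- `ord a = n < ∞`: `n` is the greatest integer such that `n a` exists. -/
def HasOrd (a : E) (n : ℕ) : Prop :=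
  IsGreatest {m : ℕ | ∃ c, mult m a = some c} n

/-- A (finitely additive) state on an effect algebra. -/
structure IsState (ω : E → ℝ) : Prop where
  mem_Icc : ∀ x, ω x ∈ Set.Icc (0 : ℝ) 1
  map_one : ω 1 = 1
  map_oplus : ∀ x y z, oplus x y = some z → ω z = ω x + ω y

variable (E) in
/-- No nonzero element has all its multiples. -/
def IsArchimedean : Prop := ∀ e : E, e ≠ 0 → ∃ n : ℕ, mult n e = none

end Basic

section Order

/-- Order convergence of a net in a poset: `u_i ↑ a`, `v_i ↓ a` and `u_i ≤ x_i ≤ v_i`. -/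
def OrderConverges {P : Type u} [PartialOrder P] {Λ : Type v} [Preorder Λ]
    (x : Λ → P) (a : P) : Prop :=
  ∃ l r : Λ → P, Monotone l ∧ IsLUB (Set.range l) a ∧ Antitone r ∧ IsGLB (Set.range r) a ∧
    ∀ i, l i ≤ x i ∧ x i ≤ r i

/-- Order-continuity of a real function on a poset. -/
def IsOrderContinuous {P : Type u} [PartialOrder P] (ω : P → ℝ) : Prop :=
  ∀ (Λ : Type u) [Preorder Λ] [IsDirectedOrder Λ] [Nonempty Λ] (x : Λ → P) (a : P),
    OrderConverges x a → Filter.Tendsto (fun i => ω (x i)) Filter.atTop (nhds (ω a))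

end Order

section Sharp

variable {E : Type u} [LatticeEffectAlgebra E]

variable (E) in
/-- The set `S(E)` of sharp elements. -/
def sharp : Set E := {x | x ⊓ orth x = 0}

theorem eq_zero_of_le_zero {a : E} (h : a ≤ 0) : a = 0 := le_bot_iff.1 h

theorem le_orth_iff {a b : E} : a ≤ orth b ↔ ∃ c, oplus a b = some c := by
  constructor
  · intro h
    obtain ⟨c, hc⟩ := (le_iff _ _).1 h
    have h1 : oplus b (orth b) = some 1 := oplus_orth b
    obtain ⟨d, hd, -⟩ := assoc_left hc h1
    exact ⟨d, by rw [oplus_comm]; exact hd⟩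
  · rintro ⟨c, hc⟩
    rw [oplus_comm] at hc
    obtain ⟨f, hf, hf'⟩ := assoc_right hc (oplus_orth c)
    rw [← eq_orth hf']
    exact (le_iff _ _).2 ⟨_, hf⟩

theorem orth_le_orth {a b : E} (h : a ≤ b) : orth b ≤ orth a := by
  obtain ⟨c, hc⟩ := (le_iff _ _).1 h
  obtain ⟨f, hf, hf'⟩ := assoc_right hc (oplus_orth b)
  rw [← eq_orth hf', le_iff]
  exact ⟨c, by rw [oplus_comm]; exact hf⟩

theorem oplus_eq_sup {a b c : E} (h : oplus a b = some c) (h0 : a ⊓ b = 0) : c = a ⊔ b := by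
  have ha : a ≤ c := (le_iff _ _).2 ⟨b, h⟩
  have h' : oplus b a = some c := by rw [oplus_comm]; exact h
  have hb : b ≤ c := (le_iff _ _).2 ⟨a, h'⟩
  obtain ⟨d, hd⟩ := (le_iff _ _).1 (sup_le ha hb)
  have key : ∀ x y : E, oplus x y = some c → x ≤ a ⊔ b → d ≤ y := by
    intro x y hxy hx
    obtain ⟨e, he⟩ := (le_iff _ _).1 hx
    obtain ⟨f, hf, hf'⟩ := assoc_right he hd
    rw [oplus_left_cancel hxy hf', le_iff]
    exact ⟨e, by rw [oplus_comm]; exact hf⟩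
  have hd0 : d = 0 := eq_zero_of_le_zero (h0 ▸ le_inf (key b a h' le_sup_right) (key a b h le_sup_left))
  rw [hd0, oplus_zero, Option.some.injEq] at hd
  exact hd.symm

theorem orth_mem_sharp {a : E} (h : a ∈ sharp E) : orth a ∈ sharp E := by
  change orth a ⊓ orth (orth a) = 0
  rw [orth_orth, inf_comm]
  exact h

theorem one_mem_sharp : (1 : E) ∈ sharp E := by
  change (1 : E) ⊓ orth 1 = 0
  rw [← eq_orth one_oplus_zero]
  exact eq_zero_of_le_zero inf_le_right

theorem zero_mem_sharp : (0 : E) ∈ sharp E := by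
  rw [eq_orth (one_oplus_zero (E := E))]
  exact orth_mem_sharp one_mem_sharp

theorem oplus_mem_sharp {a b c : E} (ha : a ∈ sharp E) (hb : b ∈ sharp E)
    (h : oplus a b = some c) : c ∈ sharp E := by
  have hab : a ⊓ b = 0 := by
    have h1 : a ≤ orth b := le_orth_iff.2 ⟨c, h⟩
    have h2 : b ⊓ orth b = 0 := hb
    exact eq_zero_of_le_zero (h2 ▸ le_inf inf_le_right (inf_le_left.trans h1))
  have hc := oplus_eq_sup h hab
  have hwa : c ⊓ orth c ≤ orth a := inf_le_right.trans (orth_le_orth (hc ▸ le_sup_left))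
  have hwb : c ⊓ orth c ≤ orth b := inf_le_right.trans (orth_le_orth (hc ▸ le_sup_right))
  have hwc : c ⊓ orth c ≤ c := inf_le_left
  change c ⊓ orth c = 0
  generalize c ⊓ orth c = w at *
  obtain ⟨d, hd⟩ := le_orth_iff.1 hwa
  have ha' : a ⊓ orth a = 0 := ha
  have hwa0 : w ⊓ a = 0 := eq_zero_of_le_zero (ha' ▸ le_inf inf_le_right (inf_le_left.trans hwa))
  have hd' := oplus_eq_sup hd hwa0
  have hdc : d ≤ c := by rw [hd']; exact sup_le hwc (hc ▸ le_sup_left)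
  obtain ⟨e, he⟩ := (le_iff _ _).1 hdc
  rw [oplus_comm] at hd
  obtain ⟨f, hf, hf'⟩ := assoc_right hd he
  have hwb' : w ≤ b := by
    rw [oplus_left_cancel h hf', le_iff]
    exact ⟨e, hf⟩
  have hb' : b ⊓ orth b = 0 := hb
  exact eq_zero_of_le_zero (hb' ▸ le_inf hwb' hwb)

theorem sharp_of_oplus {a b c : E} (ha : a ∈ sharp E) (hc : c ∈ sharp E)
    (h : oplus a b = some c) : b ∈ sharp E := by
  rw [oplus_comm] at h
  obtain ⟨f, hf, hf'⟩ := assoc_right h (oplus_orth c)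
  rw [← orth_orth b, ← eq_orth hf']
  exact orth_mem_sharp (oplus_mem_sharp ha (orth_mem_sharp hc) hf)

/-- The operation of `E` restricted to `S(E)`. -/
def sharpOplus (x y : sharp E) : Option (sharp E) :=
  (oplus x.1 y.1).pmap (fun z hz => ⟨z, hz⟩) fun _ hz => oplus_mem_sharp x.2 y.2 hz

theorem sharpOplus_eq_some {x y z : sharp E} :
    sharpOplus x y = some z ↔ oplus x.1 y.1 = some z.1 := by
  simp [sharpOplus, Option.pmap_eq_some_iff, Subtype.ext_iff]

/-- `S(E)` with the inherited operation and order is an effect algebra. -/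
instance : EffectAlgebra (sharp E) where
  zero := ⟨0, zero_mem_sharp⟩
  one := ⟨1, one_mem_sharp⟩
  oplus := sharpOplus
  oplus_comm x y := by
    ext z
    rw [sharpOplus_eq_some, sharpOplus_eq_some, oplus_comm]
  oplus_assoc x y z := by
    ext w
    simp only [Option.bind_eq_some_iff, sharpOplus_eq_some]
    constructor
    · rintro ⟨d, hd, hw⟩
      obtain ⟨f, hf, hf'⟩ := assoc_right hd hw
      exact ⟨⟨f, oplus_mem_sharp y.2 z.2 hf⟩, hf, hf'⟩
    · rintro ⟨d, hd, hw⟩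
      obtain ⟨f, hf, hf'⟩ := assoc_left hd hw
      exact ⟨⟨f, oplus_mem_sharp x.2 y.2 hf⟩, hf, hf'⟩
  existsUnique_orth x := by
    refine ⟨⟨orth x.1, orth_mem_sharp x.2⟩, sharpOplus_eq_some.2 (oplus_orth x.1), ?_⟩
    intro y hy
    exact Subtype.ext (eq_orth (sharpOplus_eq_some.1 hy))
  eq_zero_of_one_oplus x c h :=
    Subtype.ext (eq_zero_of_one_oplus x.1 c.1 (sharpOplus_eq_some.1 h))
  le_iff x y := by
    rw [← Subtype.coe_le_coe, le_iff]
    constructor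
    · rintro ⟨c, hc⟩
      exact ⟨⟨c, sharp_of_oplus x.2 y.2 hc⟩, sharpOplus_eq_some.2 hc⟩
    · rintro ⟨c, hc⟩
      exact ⟨c.1, sharpOplus_eq_some.1 hc⟩

variable (E) in
/-- Every element has a smallest sharp element above it. -/
def IsSharplyDominating : Prop := ∀ a : E, ∃ b, IsLeast {b | b ∈ sharp E ∧ a ≤ b} b

/-- `x = v ⊕ ⨁ {k a · a | a ∈ A}` is a basic decomposition of `x`: `v` is sharp, `A` is a set of
atoms, and `k a ≠ ord a` is a positive integer for each `a ∈ A`. The set `A` and the integers are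
encoded together by the multiplicity function `k : E → ℕ`, with `A = {a | k a ≠ 0}`. -/
structure IsBasicDecomposition (x : E) (v : sharp E) (k : E → ℕ) : Prop where
  isAtom : ∀ a, k a ≠ 0 → IsAtom a
  not_hasOrd : ∀ a, k a ≠ 0 → ¬ HasOrd a (k a)
  eq_oplus : ∃ (t : {a : E // k a ≠ 0} → E) (s : E),
    (∀ a : {a : E // k a ≠ 0}, mult (k a.1) a.1 = some (t a)) ∧ HasBigSum t s ∧ oplus v.1 s = some x

end Sharp

end EffectAlgebra

namespace EffectAlgebra

/-! Write `p a = ω (n_a a) / n_a` for an atom `a`. Every `x` is a sum `⨁ h a · a` of multiples of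
atoms (`exists_isAtomicSum`), usually in several ways. The point is that `∑ h a * p a` does not
depend on the chosen `h`: it is always the smeared value of `x` (`hasSum_smearing`). Additivity is
then immediate, because multiplicities of `x` and `y` add up to multiplicities of `x ⊕ y`
(`IsAtomicSum.add`).

For the independence, separate the maximal multiplicities `l a = n_a` from the others, `h = l + k`.
By `IsAtomicSum.split`, `⨁ l a · a` is the greatest sharp element `v` below `x`, and `k` gives the
rest, so `v` and `k` form the basic decomposition of `x`. The finite sums of the terms `n_a a` are
sharp and increase to `v`, so order-continuity gives `ω v = ∑ l a * p a`. The basic decomposition is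
unique because `v` is determined by `x`, and each `k a` is the largest multiple of `a` below `⨁ k a
· a`.

All of this rests on one lattice fact: an element disjoint from `a` and orthogonal to `a` stays so
for every defined multiple `n a` (`disjoint_orth_nsmul`) and for finite sums (`disjoint_orth_msum`),
while disjoint orthogonal elements satisfy `x ⊕ y = x ⊔ y`. -/

/-! ### Multiplicity functions and their finite restrictions -/

theorem exists_add_of_le_pi_add {α : Type u} {k l : α → ℕ} {f : α →₀ ℕ} (hf : ⇑f ≤ k + l) :
    ∃ g q : α →₀ ℕ, f = g + q ∧ ⇑g ≤ k ∧ ⇑q ≤ l := by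
  obtain ⟨g, hg⟩ : ∃ g : α →₀ ℕ, ∀ a, g a = min (f a) (k a) :=
    ⟨Finsupp.onFinset f.support (fun a => min (f a) (k a)) fun a ha =>
      Finsupp.mem_support_iff.2 fun h0 => ha (by rw [h0, Nat.zero_min]), fun _ => rfl⟩
  obtain ⟨q, hq⟩ := exists_add_of_le (show g ≤ f from fun a => by rw [hg]; exact min_le_left _ _)
  refine ⟨g, q, hq, fun a => by rw [hg]; exact min_le_right _ _, fun a => ?_⟩
  have h1 : f a ≤ k a + l a := hf a
  have h2 : f a = g a + q a := by rw [hq, Finsupp.add_apply]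
  have h3 := hg a
  change q a ≤ l a
  omega

/-- The finitely supported function which agrees with `k` on `F`. -/
noncomputable def restr {α : Type u} (k : α → ℕ) (F : Finset α) : α →₀ ℕ :=
  ∑ a ∈ F, Finsupp.single a (k a)

theorem restr_apply_of_mem {α : Type u} (k : α → ℕ) {F : Finset α} {a : α} (ha : a ∈ F) :
    restr k F a = k a := by
  classical
  simp [restr, Finsupp.finsetSum_apply, Finsupp.single_apply, ha]

theorem restr_apply_of_notMem {α : Type u} (k : α → ℕ) {F : Finset α} {a : α} (ha : a ∉ F) :
    restr k F a = 0 := by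
  classical
  simp [restr, Finsupp.finsetSum_apply, Finsupp.single_apply, ha]

theorem restr_le {α : Type u} (k : α → ℕ) (F : Finset α) : ⇑(restr k F) ≤ k := by
  intro a
  by_cases ha : a ∈ F
  · exact (restr_apply_of_mem k ha).le
  · rw [restr_apply_of_notMem k ha]; exact Nat.zero_le _

theorem le_restr {α : Type u} {k : α → ℕ} {f : α →₀ ℕ} (hf : ⇑f ≤ k) {F : Finset α}
    (hF : f.support ⊆ F) :
    f ≤ restr k F := by
  intro a
  by_cases ha : a ∈ f.support
  · rw [restr_apply_of_mem k (hF ha)]; exact hf a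
  · rw [Finsupp.notMem_support_iff.1 ha]; exact Nat.zero_le _

theorem restr_mono {α : Type u} (k : α → ℕ) {F G : Finset α} (h : F ⊆ G) :
    restr k F ≤ restr k G := by
  refine le_restr (restr_le k F) fun a ha => ?_
  by_contra h'
  exact Finsupp.mem_support_iff.1 ha (restr_apply_of_notMem k fun h'' => h' (h h''))

variable {E : Type u} [LatticeEffectAlgebra E]

/-! ### Partial sums as a commutative monoid with an absorbing undefined element -/

instance : Zero (Option E) := ⟨some 0⟩

instance : Add (Option E) := ⟨padd⟩

/-- Partial sums form a commutative monoid, `none` being the undefined sum. -/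
instance : AddCommMonoid (Option E) where
  add_assoc := Std.Associative.assoc (op := padd (E := E))
  add_comm := Std.Commutative.comm (op := padd (E := E))
  zero_add x := by
    change padd (some 0) x = x
    cases x <;> simp [padd, zero_oplus]
  add_zero x := by
    change padd x (some 0) = x
    cases x <;> simp [padd, oplus_zero]
  nsmul := nsmulRec

theorem option_zero_eq : (0 : Option E) = some 0 := rfl

theorem some_add_some (a b : E) : (some a + some b : Option E) = oplus a b := rfl

theorem add_eq_some_iff {x y : Option E} {c : E} :
    x + y = some c ↔ ∃ a b, x = some a ∧ y = some b ∧ oplus a b = some c := by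
  change padd x y = some c ↔ _
  cases x <;> cases y <;> simp [padd]

theorem mult_eq_nsmul (n : ℕ) (a : E) : mult n a = n • (some a : Option E) := by
  induction n with
  | zero => rw [zero_nsmul]; rfl
  | succ n ih =>
    rw [succ_nsmul, ← ih, mult]
    cases mult n a <;> rfl

/-- Both sides are the same fold, so the general theory of finite sums applies to partial sums. -/
theorem oplusSum_eq_sum {ι : Type v} (f : ι → E) (s : Finset ι) :
    oplusSum f s = ∑ i ∈ s, (some (f i) : Option E) := rfl

theorem le_of_oplus {a b c : E} (h : oplus a b = some c) : a ≤ c := (le_iff _ _).2 ⟨b, h⟩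

theorem le_of_oplus' {a b c : E} (h : oplus a b = some c) : b ≤ c :=
  le_of_oplus (by rwa [oplus_comm] at h)

theorem oplus_le_oplus {a b c a₁ b₁ : E} (ha : a₁ ≤ a) (hb : b₁ ≤ b) (h : oplus a b = some c) :
    ∃ c₁, oplus a₁ b₁ = some c₁ ∧ c₁ ≤ c := by
  obtain ⟨x, hx⟩ := (le_iff _ _).1 ha
  obtain ⟨y, hy⟩ := (le_iff _ _).1 hb
  have h1 : (some a₁ + some b₁ : Option E) + (some x + some y) = some c := by
    rw [add_add_add_comm, some_add_some, some_add_some, hx, hy, some_add_some, h]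
  obtain ⟨d, e, hd, -, hde⟩ := add_eq_some_iff.1 h1
  exact ⟨d, hd, le_of_oplus hde⟩

theorem le_of_oplus_le_oplus {a b c b₁ c₁ : E} (h : oplus a b = some c)
    (h₁ : oplus a b₁ = some c₁) (hle : c ≤ c₁) : b ≤ b₁ := by
  obtain ⟨e, he⟩ := (le_iff _ _).1 hle
  obtain ⟨f, hf, hf'⟩ := assoc_right h he
  rw [oplus_left_cancel h₁ hf']
  exact le_of_oplus hf

theorem le_orth_comm {a b : E} : a ≤ orth b ↔ b ≤ orth a := by
  rw [le_orth_iff, le_orth_iff, oplus_comm]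

/-! ### Disjoint orthogonal elements and finite sums of atoms -/

theorem inf_eq_zero_of_le {a b c d : E} (h : a ⊓ b = 0) (hc : c ≤ a) (hd : d ≤ b) : c ⊓ d = 0 :=
  eq_zero_of_le_zero (h ▸ inf_le_inf hc hd)

/-- For `w = z ⊓ c`, disjointness and orthogonality give `w ⊕ x = w ⊔ x ≤ x ⊕ y`. Cancelling `x`
yields `w ≤ y`, hence `w ≤ z ⊓ y = 0`. -/
theorem inf_oplus_eq_zero {x y z c : E} (hx : z ⊓ x = 0) (hzx : z ≤ orth x) (hy : z ⊓ y = 0)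
    (h : oplus x y = some c) : z ⊓ c = 0 := by
  have hwx : (z ⊓ c) ⊓ x = 0 := inf_eq_zero_of_le hx inf_le_left le_rfl
  obtain ⟨d, hd⟩ := le_orth_iff.1 (inf_le_left.trans hzx : z ⊓ c ≤ orth x)
  have hdc : d ≤ c := by
    rw [oplus_eq_sup hd hwx]
    exact sup_le inf_le_right (le_of_oplus h)
  rw [oplus_comm] at hd
  exact eq_zero_of_le_zero (hy ▸ le_inf inf_le_left (le_of_oplus_le_oplus hd h hdc))

/-- Since `z ⊕ x = z ⊔ x` and both `z` and `x` lie below `orth y`, the sum `(z ⊕ x) ⊕ y` is defined;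
reassociate. -/
theorem le_orth_oplus {x y z c : E} (hx : z ⊓ x = 0) (hzx : z ≤ orth x) (hzy : z ≤ orth y)
    (h : oplus x y = some c) : z ≤ orth c := by
  obtain ⟨d, hd⟩ := le_orth_iff.1 hzx
  have hdy : d ≤ orth y := by
    rw [oplus_eq_sup hd hx]
    exact sup_le hzy (le_orth_iff.2 ⟨c, h⟩)
  obtain ⟨e, he⟩ := le_orth_iff.1 hdy
  obtain ⟨f, hf, hf'⟩ := assoc_right hd he
  rw [h, Option.some.injEq] at hf
  exact le_orth_iff.2 ⟨e, by rw [hf]; exact hf'⟩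

/-- Orthogonality to a single copy of `a` already forces orthogonality to all defined multiples,
provided `z` is disjoint from `a`. -/
theorem disjoint_orth_nsmul {z a : E} (h0 : z ⊓ a = 0) (h : z ≤ orth a) (n : ℕ) :
    ∀ c, n • (some a : Option E) = some c → z ⊓ c = 0 ∧ z ≤ orth c := by
  induction n with
  | zero =>
    intro c hc
    rw [zero_nsmul, option_zero_eq, Option.some.injEq] at hc
    subst hc
    exact ⟨eq_zero_of_le_zero inf_le_right, le_orth_iff.2 ⟨z, oplus_zero z⟩⟩
  | succ n ih =>
    intro c hc
    rw [succ_nsmul] at hc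
    obtain ⟨d, e, hd, he, hde⟩ := add_eq_some_iff.1 hc
    rw [Option.some.injEq] at he
    subst he
    obtain ⟨h1, h2⟩ := ih d hd
    exact ⟨inf_oplus_eq_zero h1 h2 h0 hde, le_orth_oplus h1 h2 h hde⟩

/-- The partial sum `⨁ f a · a` (`none` if undefined). -/
noncomputable def msum : (E →₀ ℕ) →+ Option E :=
  Finsupp.liftAddHom fun a => multiplesHom (Option E) (some a)

theorem msum_single (a : E) (n : ℕ) : msum (Finsupp.single a n) = n • (some a : Option E) := by
  simp [msum]

theorem disjoint_orth_msum {z : E} (f : E →₀ ℕ) (hz : ∀ a ∈ f.support, z ⊓ a = 0 ∧ z ≤ orth a) :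
    ∀ c, msum f = some c → z ⊓ c = 0 ∧ z ≤ orth c := by
  classical
  induction f using Finsupp.induction with
  | zero =>
    intro c hc
    rw [map_zero, option_zero_eq, Option.some.injEq] at hc
    subst hc
    exact ⟨eq_zero_of_le_zero inf_le_right, le_orth_iff.2 ⟨z, oplus_zero z⟩⟩
  | single_add a n g ha hn ih =>
    intro c hc
    have hsupp : ∀ b, b ∈ (Finsupp.single a n + g).support ↔ b = a ∨ b ∈ g.support := by
      intro b
      rw [Finsupp.support_single_add ha hn, Finset.mem_cons]
    rw [map_add, msum_single] at hc
    obtain ⟨d, e, hd, he, hde⟩ := add_eq_some_iff.1 hc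
    obtain ⟨h0, h1⟩ := hz a ((hsupp a).2 (Or.inl rfl))
    obtain ⟨h2, h3⟩ := disjoint_orth_nsmul h0 h1 n d hd
    obtain ⟨h4, h5⟩ := ih (fun b hb => hz b ((hsupp b).2 (Or.inr hb))) e he
    exact ⟨inf_oplus_eq_zero h2 h3 h4 hde, le_orth_oplus h2 h3 h5 hde⟩

/-- The partial sum `o` is defined and is at most `x`. -/
def Below (o : Option E) (x : E) : Prop := ∃ c, o = some c ∧ c ≤ x

theorem below_some {c x : E} : Below (some c) x ↔ c ≤ x := by simp [Below]

theorem Below.trans {o : Option E} {x y : E} (h : Below o x) (hxy : x ≤ y) : Below o y := by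
  obtain ⟨c, hc, hcx⟩ := h
  exact ⟨c, hc, hcx.trans hxy⟩

theorem Below.left {o p : Option E} {x : E} (h : Below (o + p) x) : Below o x := by
  obtain ⟨c, hc, hcx⟩ := h
  obtain ⟨a, b, ha, -, hab⟩ := add_eq_some_iff.1 hc
  exact ⟨a, ha, (le_of_oplus hab).trans hcx⟩

theorem Below.nsmul {o : Option E} {x : E} {m n : ℕ} (h : Below (n • o) x) (hmn : m ≤ n) :
    Below (m • o) x := by
  obtain ⟨l, rfl⟩ := Nat.exists_eq_add_of_le hmn
  rw [add_nsmul] at h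
  exact h.left

theorem Below.msum_mono {f g : E →₀ ℕ} {x : E} (h : Below (msum g) x) (hfg : f ≤ g) :
    Below (msum f) x := by
  obtain ⟨l, rfl⟩ := exists_add_of_le hfg
  rw [map_add] at h
  exact h.left

theorem Below.msum_apply {f : E →₀ ℕ} {x : E} (h : Below (msum f) x) (a : E) :
    Below (f a • (some a : Option E)) x := by
  rw [← msum_single]
  exact h.msum_mono (by rw [Finsupp.single_le_iff])

theorem inf_eq_zero_or_le_of_isAtom {a : E} (ha : IsAtom a) (x : E) : a ⊓ x = 0 ∨ a ≤ x := by
  rcases ha.le_iff.1 (inf_le_left : a ⊓ x ≤ a) with h | h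
  · exact Or.inl h
  · exact Or.inr (inf_eq_left.1 h)

theorem inf_eq_zero_of_isAtom_of_ne {a b : E} (ha : IsAtom a) (hb : IsAtom b) (h : a ≠ b) :
    a ⊓ b = 0 := by
  rcases inf_eq_zero_or_le_of_isAtom ha b with h' | h'
  · exact h'
  · exact absurd (hb.le_iff.1 h') (by rintro (h1 | h1); exacts [ha.1 h1, h h1])

/-- A finite sum of multiples of distinct atoms is their join. -/
theorem msum_le {f : E →₀ ℕ} (hf : ∀ a ∈ f.support, IsAtom a) {u : E}
    (hu : ∀ a ∈ f.support, Below (f a • (some a : Option E)) u) :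
    ∀ c, msum f = some c → c ≤ u := by
  classical
  induction f using Finsupp.induction with
  | zero =>
    intro c hc
    rw [map_zero, option_zero_eq, Option.some.injEq] at hc
    subst hc
    exact bot_le
  | single_add a n g ha hn ih =>
    intro c hc
    have hsupp : ∀ b, b ∈ (Finsupp.single a n + g).support ↔ b = a ∨ b ∈ g.support := by
      intro b
      rw [Finsupp.support_single_add ha hn, Finset.mem_cons]
    have hg : ∀ b ∈ g.support, b ≠ a := fun b hb h => ha (h ▸ hb)
    rw [map_add, msum_single] at hc
    obtain ⟨d, e, hd, he, hde⟩ := add_eq_some_iff.1 hc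
    have had : a ≤ d := by
      have h1 : Below (n • (some a : Option E)) d := ⟨d, hd, le_rfl⟩
      have := h1.nsmul (Nat.one_le_iff_ne_zero.2 hn)
      rwa [one_nsmul, below_some] at this
    -- Single atoms suffice: `a` is disjoint from and orthogonal to every atom of `g`, hence to `e`;
    -- then `e` is disjoint from `d = n a`, and `d ⊕ e` is a join.
    have hae : a ≤ orth e := had.trans (le_orth_iff.2 ⟨c, hde⟩)
    have h1 : a ⊓ e = 0 := by
      refine (disjoint_orth_msum g (fun b hb => ?_) e he).1
      have hbe : b ≤ e := by
        have h1 : Below (msum g) e := ⟨e, he, le_rfl⟩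
        have := (h1.msum_apply b).nsmul (Nat.one_le_iff_ne_zero.2 (Finsupp.mem_support_iff.1 hb))
        rwa [one_nsmul, below_some] at this
      exact ⟨inf_eq_zero_of_isAtom_of_ne (hf a ((hsupp a).2 (Or.inl rfl)))
        (hf b ((hsupp b).2 (Or.inr hb))) (hg b hb).symm, hae.trans (orth_le_orth hbe)⟩
    have h2 : d ⊓ e = 0 := by
      rw [inf_comm]
      exact (disjoint_orth_nsmul (by rwa [inf_comm]) (le_orth_comm.1 hae) n d hd).1
    rw [oplus_eq_sup hde h2]
    refine sup_le ?_ (ih (fun b hb => hf b ((hsupp b).2 (Or.inr hb))) (fun b hb => ?_) e he)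
    · have := hu a ((hsupp a).2 (Or.inl rfl))
      rw [Finsupp.add_apply, Finsupp.single_eq_same, Finsupp.notMem_support_iff.1 ha, add_zero, hd,
        below_some] at this
      exact this
    · have := hu b ((hsupp b).2 (Or.inr hb))
      rwa [Finsupp.add_apply, Finsupp.single_eq_of_ne (hg b hb), zero_add] at this

/-! ### Atomic sums -/

/-- `x = ⨁ k a · a`, where the sum runs over the atoms `a` with `k a ≠ 0`: the element `x` is the
supremum of the finite sums `⨁ f a · a` with `f ≤ k`. -/
structure IsAtomicSum (k : E → ℕ) (x : E) : Prop where
  isAtom : ∀ a, k a ≠ 0 → IsAtom a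
  below : ∀ f : E →₀ ℕ, ⇑f ≤ k → Below (msum f) x
  le : ∀ u, (∀ f : E →₀ ℕ, ⇑f ≤ k → Below (msum f) u) → x ≤ u

namespace IsAtomicSum

variable {k l : E → ℕ} {x y z : E}

theorem isAtom_of_mem_support (h : IsAtomicSum k x) {f : E →₀ ℕ} (hf : ⇑f ≤ k) {a : E}
    (ha : a ∈ f.support) : IsAtom a :=
  h.isAtom a fun h0 => Finsupp.mem_support_iff.1 ha (Nat.le_zero.1 (h0 ▸ hf a))

theorem below_nsmul (h : IsAtomicSum k x) (a : E) : Below (k a • (some a : Option E)) x := by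
  rw [← msum_single]
  classical
  refine h.below _ fun b => ?_
  rw [Finsupp.single_apply]
  split_ifs with hb
  · rw [hb]
  · exact Nat.zero_le _

theorem le_orth_of_ne (h : IsAtomicSum k x) {a b : E} (ha : k a ≠ 0) (hb : k b ≠ 0)
    (hab : a ≠ b) : a ≤ orth b := by
  classical
  have : Below (msum (Finsupp.single a 1 + Finsupp.single b 1)) x := by
    refine h.below _ fun c => ?_
    rw [Finsupp.add_apply, Finsupp.single_apply, Finsupp.single_apply]
    split_ifs with h1 h2 h2
    · exact absurd (h1.trans h2.symm) hab
    · exact h1 ▸ Nat.one_le_iff_ne_zero.2 ha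
    · exact h2 ▸ Nat.one_le_iff_ne_zero.2 hb
    · exact Nat.zero_le _
  rw [map_add, msum_single, msum_single, one_nsmul, one_nsmul, some_add_some] at this
  obtain ⟨c, hc, -⟩ := this
  exact le_orth_iff.2 ⟨c, hc⟩

/-- The multiplicity of an atom orthogonal to the others is the greatest possible one. -/
theorem le_orth_and_not_le (h : IsAtomicSum k x) {b e : E} (hb : IsAtom b)
    (he : (k b + 1) • (some b : Option E) = some e) (hk : ∀ a, k a ≠ 0 → a ≠ b → a ≤ orth b) :
    x ≤ orth b ∧ ¬ e ≤ x := by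
  have hbe : Below ((k b + 1) • (some b : Option E)) e := ⟨e, he, le_rfl⟩
  -- Each finite sum is a join of terms `f a · a`. These lie below `orth b`: for `a = b` because one
  -- more copy of `b` can still be added, otherwise by disjointness.
  have hx : x ≤ orth b := by
    refine h.le _ fun f hf => ?_
    obtain ⟨c, hc, -⟩ := h.below f hf
    refine ⟨c, hc, msum_le (fun a ha => h.isAtom_of_mem_support hf ha) (fun a ha => ?_) c hc⟩
    have hcc : Below (msum f) c := ⟨c, hc, le_rfl⟩
    obtain ⟨d, hd, -⟩ := hcc.msum_apply a
    refine ⟨d, hd, ?_⟩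
    by_cases hab : a = b
    · subst hab
      have := hbe.nsmul (Nat.succ_le_succ (hf a))
      rw [succ_nsmul, hd] at this
      obtain ⟨g, hg, -⟩ := this
      exact le_orth_iff.2 ⟨g, hg⟩
    · have hka : k a ≠ 0 := fun h0 =>
        Finsupp.mem_support_iff.1 ha (Nat.le_zero.1 (h0 ▸ hf a))
      exact le_orth_comm.1 (disjoint_orth_nsmul
        (inf_eq_zero_of_isAtom_of_ne hb (h.isAtom a hka) (Ne.symm hab))
        (le_orth_comm.1 (hk a hka hab)) _ d hd).2
  refine ⟨hx, fun hex => ?_⟩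
  have hbx : b ≤ x := by
    have := hbe.nsmul (Nat.le_add_left 1 _)
    rw [one_nsmul, below_some] at this
    exact this.trans hex
  -- If `e ≤ x`, every finite sum stays below `x` after adding one more `b`. With `x = b ⊕ y`, all
  -- finite sums are then below `y`, so `x = y` and `b = 0`.
  obtain ⟨y, hy⟩ := (le_iff _ _).1 hbx
  have hxy : x ≤ y := by
    refine h.le _ fun f hf => ?_
    obtain ⟨c, hc, hcx⟩ := h.below f hf
    refine ⟨c, hc, ?_⟩
    obtain ⟨g, hg⟩ := le_orth_iff.1 (hcx.trans hx)
    have hg' : msum (f + Finsupp.single b 1) = some g := by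
      rw [map_add, msum_single, one_nsmul, hc, some_add_some, hg]
    have hgx : g ≤ x := by
      classical
      refine msum_le (fun a ha => ?_) (fun a ha => ?_) g hg'
      · rcases Finset.mem_union.1 (Finsupp.support_add ha) with h1 | h1
        · exact h.isAtom_of_mem_support hf h1
        · rw [Finset.mem_singleton.1 (Finsupp.support_single_subset h1)]; exact hb
      · by_cases hab : a = b
        · subst hab
          rw [Finsupp.add_apply, Finsupp.single_eq_same]
          exact (hbe.nsmul (Nat.succ_le_succ (hf a))).trans hex
        · rw [Finsupp.add_apply, Finsupp.single_eq_of_ne hab, add_zero]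
          exact (h.below f hf).msum_apply a
    rw [oplus_comm] at hg
    exact le_of_oplus_le_oplus hg hy hgx
  have : y = x := le_antisymm (le_of_oplus' hy) hxy
  subst this
  rw [oplus_comm] at hy
  exact hb.1 (oplus_left_cancel hy (oplus_zero y))

theorem le_orth (h : IsAtomicSum k x) {a e : E} (ha : k a ≠ 0)
    (he : (k a + 1) • (some a : Option E) = some e) : x ≤ orth a :=
  (h.le_orth_and_not_le (h.isAtom a ha) he fun _ hb hba => h.le_orth_of_ne hb ha hba).1

/-- When no multiplicity is maximal, an atom `b ≤ x` is orthogonal to every summand, because `x ≤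
orth a` for each of them. Hence `k b` is the largest multiple of `b` below `x`, a quantity that
depends on `x` alone. -/
theorem not_le_of_forall (h : IsAtomicSum k x)
    (hk : ∀ a, k a ≠ 0 → ∃ e, (k a + 1) • (some a : Option E) = some e) {b : E} (hb : IsAtom b) :
    ¬ Below ((k b + 1) • (some b : Option E)) x := by
  rintro ⟨e, he, hex⟩
  refine (h.le_orth_and_not_le hb he fun a ha _ => ?_).2 hex
  obtain ⟨d, hd⟩ := hk a ha
  have hbe : Below ((k b + 1) • (some b : Option E)) e := ⟨e, he, le_rfl⟩
  have hbe := hbe.nsmul (Nat.le_add_left 1 _)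
  rw [one_nsmul, below_some] at hbe
  exact le_orth_comm.1 ((hbe.trans hex).trans (h.le_orth ha hd))

/-- An atom `b ≤ s` must have `k b ≠ 0`, as `0` would not be its largest multiple below `x`. Then `s
≤ x ≤ orth b`, so `b ≤ s ⊓ orth s = 0`. -/
theorem eq_zero_of_sharp [IsAtomic E] (h : IsAtomicSum k x)
    (hk : ∀ a, k a ≠ 0 → ∃ e, (k a + 1) • (some a : Option E) = some e) {s : E} (hs : s ∈ sharp E)
    (hsx : s ≤ x) : s = 0 := by
  rcases eq_bot_or_exists_atom_le s with h0 | ⟨b, hb, hbs⟩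
  · exact h0
  exfalso
  by_cases hkb : k b = 0
  · refine h.not_le_of_forall hk hb ?_
    rw [hkb, zero_add, one_nsmul, below_some]
    exact hbs.trans hsx
  · obtain ⟨e, he⟩ := hk b hkb
    have h1 : b ≤ orth s := le_orth_comm.1 (hsx.trans (h.le_orth hkb he))
    have h2 : s ⊓ orth s = 0 := hs
    exact hb.1 (eq_zero_of_le_zero (h2 ▸ le_inf hbs h1))

theorem unique (hk : IsAtomicSum k x) (hl : IsAtomicSum l x)
    (hk' : ∀ a, k a ≠ 0 → ∃ e, (k a + 1) • (some a : Option E) = some e)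
    (hl' : ∀ a, l a ≠ 0 → ∃ e, (l a + 1) • (some a : Option E) = some e) : k = l := by
  have key : ∀ {k l : E → ℕ}, IsAtomicSum k x → IsAtomicSum l x →
      (∀ a, k a ≠ 0 → ∃ e, (k a + 1) • (some a : Option E) = some e) → l ≤ k := by
    intro k l hk hl hk' a
    by_contra! hlt
    exact hk.not_le_of_forall hk' (hl.isAtom a (Nat.ne_zero_of_lt hlt))
      ((hl.below_nsmul a).nsmul hlt)
  exact le_antisymm (key hl hk hl') (key hk hl hk')

/-- Adding a fixed element preserves suprema, as one sees by subtracting it from an upper bound.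
This is used twice: with a finite sum of `y` fixed while those of `x` vary, then with `x` fixed. -/
theorem add (hx : IsAtomicSum k x) (hy : IsAtomicSum l y) (h : oplus x y = some z) :
    IsAtomicSum (k + l) z where
  isAtom a ha := by
    by_cases h0 : k a = 0
    · exact hy.isAtom a (by simpa [h0] using ha)
    · exact hx.isAtom a h0
  below f hf := by
    obtain ⟨g, q, hq, hgk, hql⟩ := exists_add_of_le_pi_add hf
    obtain ⟨c, hc, hcx⟩ := hx.below g hgk
    obtain ⟨d, hd, hdy⟩ := hy.below q hql
    obtain ⟨e, he, hez⟩ := oplus_le_oplus hcx hdy h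
    exact ⟨e, by rw [hq, map_add, hc, hd, some_add_some, he], hez⟩
  le u hu := by
    have h1 : ∀ g : E →₀ ℕ, ⇑g ≤ l → ∃ d e, msum g = some d ∧ oplus x d = some e ∧ e ≤ u := by
      intro g hg
      obtain ⟨d, hd, hdy⟩ := hy.below g hg
      obtain ⟨e, he, hez⟩ := oplus_le_oplus le_rfl hdy h
      refine ⟨d, e, hd, he, ?_⟩
      have hdu : d ≤ u ⊓ e := by
        refine le_inf ?_ (le_of_oplus' he)
        have := hu g fun a => (hg a).trans (Nat.le_add_left _ _)
        rwa [hd, below_some] at this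
      obtain ⟨w, hw⟩ := (le_iff _ _).1 hdu
      have hxw : x ≤ w := by
        refine hx.le _ fun f hf => ?_
        obtain ⟨c, hc, hcx⟩ := hx.below f hf
        refine ⟨c, hc, ?_⟩
        obtain ⟨b, hb, hbe⟩ := oplus_le_oplus hcx le_rfl he
        have hbu := hu (f + g) (fun a => Nat.add_le_add (hf a) (hg a))
        rw [map_add, hc, hd, some_add_some, hb, below_some] at hbu
        rw [oplus_comm] at hb
        exact le_of_oplus_le_oplus hb hw (le_inf hbu hbe)
      rw [oplus_comm] at hw
      obtain ⟨b, hb, hbu⟩ := oplus_le_oplus hxw le_rfl hw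
      rw [he, Option.some.injEq] at hb
      rw [hb]
      exact hbu.trans inf_le_left
    have hxu : x ≤ u ⊓ z := by
      refine le_inf ?_ (le_of_oplus h)
      obtain ⟨d, e, -, he, heu⟩ := h1 0 fun a => Nat.zero_le _
      exact (le_of_oplus he).trans heu
    obtain ⟨w, hw⟩ := (le_iff _ _).1 hxu
    have hyw : y ≤ w := by
      refine hy.le _ fun g hg => ?_
      obtain ⟨d, e, hd, he, heu⟩ := h1 g hg
      refine ⟨d, hd, le_of_oplus_le_oplus he hw (le_inf heu ?_)⟩
      obtain ⟨d', hd', hdy⟩ := hy.below g hg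
      rw [hd, Option.some.injEq] at hd'
      obtain ⟨e', he', hez⟩ := oplus_le_oplus le_rfl (hd' ▸ hdy) h
      rw [he, Option.some.injEq] at he'
      exact he' ▸ hez
    obtain ⟨b, hb, hbu⟩ := oplus_le_oplus le_rfl hyw hw
    rw [h, Option.some.injEq] at hb
    rw [hb]
    exact hbu.trans inf_le_left

end IsAtomicSum

theorem isAtomicSum_single {a : E} (ha : IsAtom a) : IsAtomicSum (⇑(Finsupp.single a 1)) a where
  isAtom b hb := by
    classical
    rw [Finsupp.single_apply] at hb
    split_ifs at hb with h
    · exact h ▸ ha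
    · exact absurd rfl hb
  below f hf := by
    have : Below (msum (Finsupp.single a 1)) a := by
      rw [msum_single, one_nsmul, below_some]
    exact this.msum_mono hf
  le u hu := by
    have := hu _ le_rfl
    rwa [msum_single, one_nsmul, below_some] at this

/-! ### Existence of orders and of atomic sums -/

theorem exists_nsmul_eq_none (hA : IsArchimedean E) {a : E} (ha : a ≠ 0) :
    ∃ n, 0 < n ∧ (∃ c, n • (some a : Option E) = some c) ∧
      (n + 1) • (some a : Option E) = none := by
  classical
  obtain ⟨m, hm⟩ := hA a ha
  rw [mult_eq_nsmul] at hm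
  have hex : ∃ m, m • (some a : Option E) = none := ⟨m, hm⟩
  -- The multiples `0 a` and `1 a` are defined, so the first undefined one has index at least 2 and
  -- the order, one less, is positive.
  obtain ⟨n, hn⟩ : ∃ n, Nat.find hex = n + 2 := by
    have h0 : Nat.find hex ≠ 0 := fun h => by
      have := Nat.find_spec hex
      rw [h, zero_nsmul] at this
      cases this
    have h1 : Nat.find hex ≠ 1 := fun h => by
      have := Nat.find_spec hex
      rw [h, one_nsmul] at this
      cases this
    exact ⟨Nat.find hex - 2, by omega⟩
  refine ⟨n + 1, n.succ_pos, ?_, hn ▸ Nat.find_spec hex⟩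
  exact Option.ne_none_iff_exists'.1 (Nat.find_min hex (by omega))

theorem nsmul_le_of_eq_none {a : E} {n m : ℕ} (hn : (n + 1) • (some a : Option E) = none) {c : E}
    (hm : m • (some a : Option E) = some c) : m ≤ n := by
  by_contra! h
  have : Below (m • (some a : Option E)) c := ⟨c, hm, le_rfl⟩
  obtain ⟨d, hd, -⟩ := this.nsmul h
  rw [Nat.succ_eq_add_one, hn] at hd
  cases hd

/-- Zorn: take a maximal `k` whose finite sums all lie below `x`. If `u` bounds them and `u ⊓ x <
x`, an atom below the difference could be added to `k`. -/
theorem exists_isAtomicSum [IsAtomic E] (hA : IsArchimedean E) (x : E) :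
    ∃ k, IsAtomicSum k x := by
  classical
  let P : Set (E → ℕ) :=
    {k | (∀ a, k a ≠ 0 → IsAtom a) ∧ ∀ f : E →₀ ℕ, ⇑f ≤ k → Below (msum f) x}
  have hP0 : (0 : E → ℕ) ∈ P := by
    refine ⟨fun a ha => absurd rfl ha, fun f hf => ?_⟩
    have : f = 0 := Finsupp.ext fun a => Nat.le_zero.1 (hf a)
    rw [this, map_zero, option_zero_eq, below_some]
    exact bot_le
  have hchain : ∀ c ⊆ P, IsChain (· ≤ ·) c → ∀ y ∈ c, ∃ ub ∈ P, ∀ z ∈ c, z ≤ ub := by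
    intro c hcP hc y hy
    have hbdd : ∀ a, BddAbove ((fun k : E → ℕ => k a) '' c) := by
      intro a
      by_cases ha : a = 0
      · refine ⟨0, ?_⟩
        rintro _ ⟨k, hk, rfl⟩
        by_contra h
        exact ((hcP hk).1 a (by simpa using h)).1 ha
      · obtain ⟨n, -, -, hn⟩ := exists_nsmul_eq_none hA ha
        refine ⟨n, ?_⟩
        rintro _ ⟨k, hk, rfl⟩
        obtain ⟨d, hd, -⟩ := (hcP hk).2 (Finsupp.single a (k a)) fun b => by
          rw [Finsupp.single_apply]
          split_ifs with hb
          · rw [hb]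
          · exact Nat.zero_le _
        rw [msum_single] at hd
        exact nsmul_le_of_eq_none hn hd
    have hmem : ∀ a, ∃ k ∈ c, k a = sSup ((fun k : E → ℕ => k a) '' c) := fun a =>
      Nat.sSup_mem (Set.Nonempty.image _ ⟨y, hy⟩) (hbdd a)
    refine ⟨fun a => sSup ((fun k : E → ℕ => k a) '' c), ⟨fun a ha => ?_, fun f hf => ?_⟩,
      fun k hk a => le_csSup (hbdd a) ⟨k, hk, rfl⟩⟩
    · obtain ⟨k, hk, hka⟩ := hmem a
      exact (hcP hk).1 a (hka ▸ ha)
    -- The pointwise suprema are bounded in `ℕ`, hence attained; on a finite support a single member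
    -- of the chain dominates `f`.
    · have key : ∀ s : Finset E, ∃ k ∈ c, ∀ a ∈ s, f a ≤ k a := by
        intro s
        induction s using Finset.induction_on with
        | empty => exact ⟨y, hy, by simp⟩
        | insert a s _ ih =>
          obtain ⟨k, hk, hks⟩ := ih
          obtain ⟨l, hl, hla⟩ := hmem a
          have hfa : f a ≤ l a := hla ▸ hf a
          rcases hc.total hk hl with h | h
          · refine ⟨l, hl, fun b hb => ?_⟩
            rcases Finset.mem_insert.1 hb with rfl | hb
            · exact hfa
            · exact (hks b hb).trans (h b)
          · refine ⟨k, hk, fun b hb => ?_⟩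
            rcases Finset.mem_insert.1 hb with rfl | hb
            · exact hfa.trans (h b)
            · exact hks b hb
      obtain ⟨k, hk, hfk⟩ := key f.support
      refine (hcP hk).2 f fun a => ?_
      by_cases ha : a ∈ f.support
      · exact hfk a ha
      · rw [Finsupp.notMem_support_iff.1 ha]; exact Nat.zero_le _
  obtain ⟨k, -, hk⟩ := zorn_le_nonempty₀ P hchain 0 hP0
  refine ⟨k, hk.prop.1, hk.prop.2, fun u hu => ?_⟩
  obtain ⟨w, hw⟩ := (le_iff _ _).1 (inf_le_right : u ⊓ x ≤ x)
  rcases eq_bot_or_exists_atom_le w with h0 | ⟨b, hb, hbw⟩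
  · have hw0 : w = 0 := h0
    rw [hw0, oplus_zero, Option.some.injEq] at hw
    exact inf_eq_right.1 hw
  · exfalso
    have hmem : k + ⇑(Finsupp.single b 1) ∈ P := by
      refine ⟨fun a ha => ?_, fun f hf => ?_⟩
      · by_cases hab : a = b
        · exact hab ▸ hb
        · refine hk.prop.1 a ?_
          rwa [Pi.add_apply, Finsupp.single_eq_of_ne hab, add_zero] at ha
      -- The subtraction is truncated, so `f` is only at most `(f - single b 1) + single b 1`, which
      -- suffices.
      · have hle : ⇑(f - Finsupp.single b 1 : E →₀ ℕ) ≤ k := by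
          intro a
          rw [Finsupp.tsub_apply]
          exact tsub_le_iff_right.2 (hf a)
        obtain ⟨c, hc, hcx⟩ := hk.prop.2 _ hle
        have hcu : c ≤ u := by
          have := hu _ hle
          rwa [hc, below_some] at this
        obtain ⟨e, he, hex⟩ := oplus_le_oplus (le_inf hcu hcx) hbw hw
        have : Below (msum (f - Finsupp.single b 1 + Finsupp.single b 1)) x :=
          ⟨e, by rw [map_add, hc, msum_single, one_nsmul, some_add_some, he], hex⟩
        exact this.msum_mono le_tsub_add
    have := hk.le_of_ge hmem (fun a => Nat.le_add_right _ _) b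
    rw [Pi.add_apply, Finsupp.single_eq_same] at this
    exact Nat.not_succ_le_self _ this

/-! ### Sharp elements and maximal multiples of atoms -/

/-- If `a ≤ orth w`, then `(n + 1) a` would be defined. Otherwise `w ⊓ orth w` is disjoint from `a`
and orthogonal to it, hence disjoint from `n a = w`, so it is `0`. -/
theorem mem_sharp_of_nsmul_eq_none {a w : E} {n : ℕ} (ha : IsAtom a)
    (hn : n • (some a : Option E) = some w) (hn' : (n + 1) • (some a : Option E) = none) :
    w ∈ sharp E := by
  have haw : a ≤ w := by
    have h1 : Below (n • (some a : Option E)) w := ⟨w, hn, le_rfl⟩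
    have h2 := h1.nsmul (nsmul_le_of_eq_none hn' (one_nsmul (some a)))
    rwa [one_nsmul, below_some] at h2
  change w ⊓ orth w = 0
  rcases inf_eq_zero_or_le_of_isAtom ha (w ⊓ orth w) with h | h
  · have := (disjoint_orth_nsmul (by rwa [inf_comm] at h)
      (inf_le_right.trans (orth_le_orth haw)) n w hn).1
    rwa [inf_eq_left.2 inf_le_left] at this
  · obtain ⟨c, hc⟩ := le_orth_iff.1 (h.trans inf_le_right)
    rw [succ_nsmul, hn, some_add_some, oplus_comm, hc] at hn'
    cases hn'

/-- Sharpness makes `orth v` disjoint from `a`, as well as orthogonal to it, so it is orthogonal to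
`n a`. -/
theorem nsmul_le_of_le_sharp {a v w : E} {n : ℕ} (hv : v ∈ sharp E) (hav : a ≤ v)
    (hn : n • (some a : Option E) = some w) : w ≤ v := by
  have hv' : v ⊓ orth v = 0 := hv
  have := (disjoint_orth_nsmul (z := orth v)
    (by rw [inf_comm]; exact inf_eq_zero_of_le hv' hav le_rfl)
    (orth_le_orth hav) n w hn).2
  rw [le_orth_comm, orth_orth] at this
  exact this

/-- Sharp domination of `orth x`, dualized by the orthosupplement. -/
theorem exists_isGreatest_sharp (hS : IsSharplyDominating E) (x : E) :
    ∃ v, IsGreatest {s | s ∈ sharp E ∧ s ≤ x} v := by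
  obtain ⟨b, ⟨hb, hxb⟩, hmin⟩ := hS (orth x)
  refine ⟨orth b, ⟨orth_mem_sharp hb, ?_⟩, fun s hs => ?_⟩
  · rw [← orth_orth x]; exact orth_le_orth hxb
  · exact le_orth_comm.1 (hmin ⟨orth_mem_sharp hs.1, orth_le_orth hs.2⟩)

theorem msum_restr (k : E → ℕ) (F : Finset E) :
    msum (restr k F) = ∑ a ∈ F, k a • (some a : Option E) := by
  simp only [restr, map_sum, msum_single]

theorem msum_restr_mem_sharp {k : E → ℕ} (F : Finset E)
    (hk : ∀ a ∈ F, k a ≠ 0 → IsAtom a ∧ (k a + 1) • (some a : Option E) = none) :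
    ∀ c, msum (restr k F) = some c → c ∈ sharp E := by
  classical
  rw [msum_restr]
  induction F using Finset.induction_on with
  | empty =>
    intro c hc
    rw [Finset.sum_empty, option_zero_eq, Option.some.injEq] at hc
    exact hc ▸ zero_mem_sharp
  | insert a F ha ih =>
    intro c hc
    rw [Finset.sum_insert ha] at hc
    obtain ⟨d, e, hd, he, hde⟩ := add_eq_some_iff.1 hc
    refine oplus_mem_sharp ?_ (ih (fun b hb => hk b (Finset.mem_insert_of_mem hb)) e he) hde
    by_cases h0 : k a = 0
    · rw [h0, zero_nsmul, option_zero_eq, Option.some.injEq] at hd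
      exact hd ▸ zero_mem_sharp
    · obtain ⟨h1, h2⟩ := hk a (Finset.mem_insert_self a F) h0
      exact mem_sharp_of_nsmul_eq_none h1 hd h2

namespace IsAtomicSum

variable {k l : E → ℕ} {x v m : E}

/-- If `u` bounds the finite sums of `k`, then `(u ⊓ v) ⊕ m` bounds those of `k + l`, so it is at
least `v ⊕ m`. Cancel `m`. -/
theorem of_add (h : IsAtomicSum (k + l) x) (hvm : oplus v m = some x)
    (hk : ∀ f : E →₀ ℕ, ⇑f ≤ k → Below (msum f) v)
    (hl : ∀ f : E →₀ ℕ, ⇑f ≤ l → Below (msum f) m) : IsAtomicSum k v where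
  isAtom a ha := h.isAtom a (by rw [Pi.add_apply]; omega)
  below := hk
  le u hu := by
    obtain ⟨g, hg, -⟩ := oplus_le_oplus (inf_le_right : u ⊓ v ≤ v) le_rfl hvm
    have hxg : x ≤ g := by
      refine h.le _ fun f hf => ?_
      obtain ⟨p, q, rfl, hp, hq⟩ := exists_add_of_le_pi_add hf
      obtain ⟨c, hc, hcv⟩ := hk p hp
      obtain ⟨d, hd, hdm⟩ := hl q hq
      have hcu := hu p hp
      rw [hc, below_some] at hcu
      obtain ⟨e, he, heg⟩ := oplus_le_oplus (le_inf hcu hcv) hdm hg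
      exact ⟨e, by rw [map_add, hc, hd, some_add_some, he], heg⟩
    rw [oplus_comm] at hvm hg
    exact (le_of_oplus_le_oplus hvm hg hxg).trans inf_le_left

/-- A sum of multiples of atoms splits into the greatest sharp element below it, which is the sum
of the maximal multiples, and the sum of the other multiples. -/
theorem split (h : IsAtomicSum (k + l) x) (hv : IsGreatest {s | s ∈ sharp E ∧ s ≤ x} v)
    (hvm : oplus v m = some x)
    (hk : ∀ a, k a ≠ 0 → l a = 0 ∧ (k a + 1) • (some a : Option E) = none)
    (hl : ∀ a, l a ≠ 0 → k a = 0 ∧ ∃ e, (l a + 1) • (some a : Option E) = some e) :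
    IsAtomicSum k v ∧ IsAtomicSum l m := by
  have hkl : k ≤ k + l := fun a => Nat.le_add_right _ _
  have hlk : l ≤ k + l := fun a => Nat.le_add_left _ _
  have hbk : ∀ f : E →₀ ℕ, ⇑f ≤ k → Below (msum f) v := by
    intro f hf
    obtain ⟨c, hc, hcx⟩ := h.below _ ((restr_le k f.support).trans hkl)
    have hs : c ∈ sharp E := msum_restr_mem_sharp f.support
      (fun a _ ha => ⟨h.isAtom a (by rw [Pi.add_apply]; omega), (hk a ha).2⟩) c hc
    have : Below (msum (restr k f.support)) v := ⟨c, hc, hv.2 ⟨hs, hcx⟩⟩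
    exact this.msum_mono (le_restr hf subset_rfl)
  have hbl : ∀ f : E →₀ ℕ, ⇑f ≤ l → Below (msum f) m := by
    intro f hf
    obtain ⟨d, hd, hdx⟩ := h.below f (hf.trans hlk)
    refine ⟨d, hd, ?_⟩
    -- An atom `a` with `l a ≠ 0` is orthogonal to `x ≥ v`. It is disjoint from `v`, since `a ≤ v`
    -- would put `(l a + 1) a` below the sharp `v`, hence below `x`. So `v ⊕ d = v ⊔ d ≤ x = v ⊕ m`,
    -- and `v` cancels.
    obtain ⟨h0, h1⟩ := disjoint_orth_msum (z := v) f (fun a ha => by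
      have hla : l a ≠ 0 := fun h0 => Finsupp.mem_support_iff.1 ha (Nat.le_zero.1 (h0 ▸ hf a))
      obtain ⟨hka, e, he⟩ := hl a hla
      have hkla : (k + l) a = l a := by rw [Pi.add_apply, hka, zero_add]
      rw [← hkla] at he hla
      obtain ⟨h2, h3⟩ := h.le_orth_and_not_le (h.isAtom a hla) he
        fun _ hb hba => h.le_orth_of_ne hb hla hba
      refine ⟨?_, hv.1.2.trans h2⟩
      rw [inf_comm]
      refine (inf_eq_zero_or_le_of_isAtom (h.isAtom a hla) v).resolve_right fun hav => h3 ?_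
      exact (nsmul_le_of_le_sharp hv.1.1 hav he).trans hv.1.2) d hd
    obtain ⟨g, hg⟩ := le_orth_iff.1 h1
    refine le_of_oplus_le_oplus hg hvm ?_
    rw [oplus_eq_sup hg h0]
    exact sup_le hv.1.2 hdx
  refine ⟨h.of_add hvm hbk hbl, ?_⟩
  rw [add_comm] at h
  rw [oplus_comm] at hvm
  exact h.of_add hvm hbl hbk

end IsAtomicSum

/-! ### Basic decompositions -/

/-- The sums of full terms `k a · a` over finite sets are cofinal among the sums with finitely
supported `f ≤ k`. -/
theorem hasBigSum_iff_isAtomicSum {k : E → ℕ} (hk : ∀ a, k a ≠ 0 → IsAtom a)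
    {t : {a : E // k a ≠ 0} → E} (ht : ∀ a, mult (k a.1) a.1 = some (t a)) {s : E} :
    HasBigSum t s ↔ IsAtomicSum k s := by
  classical
  have hsum : ∀ F : Finset {a : E // k a ≠ 0},
      oplusSum t F = msum (restr k (F.map (Function.Embedding.subtype _))) := by
    intro F
    rw [oplusSum_eq_sum, msum_restr, Finset.sum_map]
    refine Finset.sum_congr rfl fun a _ => ?_
    rw [← ht, mult_eq_nsmul]
    rfl
  have hle : ∀ f : E →₀ ℕ, ⇑f ≤ k →
      ∃ F : Finset {a : E // k a ≠ 0},
        f ≤ restr k (F.map (Function.Embedding.subtype _)) := by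
    intro f hf
    refine ⟨f.support.subtype _, le_restr hf fun a ha => ?_⟩
    have hka : k a ≠ 0 := fun h0 => Finsupp.mem_support_iff.1 ha (Nat.le_zero.1 (h0 ▸ hf a))
    rw [Finset.mem_map]
    exact ⟨⟨a, hka⟩, Finset.mem_subtype.2 ha, rfl⟩
  constructor
  · rintro ⟨hdef, hlub⟩
    refine ⟨hk, fun f hf => ?_, fun u hu => ?_⟩
    · obtain ⟨F, hF⟩ := hle f hf
      obtain ⟨c, hc⟩ := hdef F
      have : Below (oplusSum t F) s := ⟨c, hc, hlub.1 ⟨F, hc⟩⟩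
      rw [hsum] at this
      exact this.msum_mono hF
    · refine hlub.2 ?_
      rintro c ⟨F, hF⟩
      have := hu _ (restr_le k (F.map (Function.Embedding.subtype _)))
      rwa [← hsum, hF, below_some] at this
  · intro h
    refine ⟨fun F => ?_, ?_, fun u hu => ?_⟩
    · obtain ⟨c, hc, -⟩ := h.below _ (restr_le k (F.map (Function.Embedding.subtype _)))
      exact ⟨c, (hsum F).trans hc⟩
    · rintro c ⟨F, hF⟩
      have := h.below _ (restr_le k (F.map (Function.Embedding.subtype _)))
      rwa [← hsum, hF, below_some] at this
    · refine h.le u fun f hf => ?_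
      obtain ⟨F, hF⟩ := hle f hf
      obtain ⟨c, hc, -⟩ := h.below _ (restr_le k (F.map (Function.Embedding.subtype _)))
      have : Below (msum (restr k (F.map (Function.Embedding.subtype _)))) u :=
        ⟨c, hc, hu ⟨F, (hsum F).trans hc⟩⟩
      exact this.msum_mono hF

theorem hasOrd_iff {a : E} {n : ℕ} {c : E} (hn : n • (some a : Option E) = some c) :
    HasOrd a n ↔ (n + 1) • (some a : Option E) = none := by
  constructor
  · intro h
    by_contra h'
    obtain ⟨d, hd⟩ := Option.ne_none_iff_exists'.1 h'
    have := h.2 ⟨d, (mult_eq_nsmul _ _).trans hd⟩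
    omega
  · intro h
    refine ⟨⟨c, (mult_eq_nsmul _ _).trans hn⟩, ?_⟩
    rintro m ⟨d, hd⟩
    rw [mult_eq_nsmul] at hd
    exact nsmul_le_of_eq_none h hd

/-- The condition `k a ≠ ord a` is traded for its usable form: one more copy of `a` can be added. -/
theorem isBasicDecomposition_iff {x : E} {v : sharp E} {k : E → ℕ} :
    IsBasicDecomposition x v k ↔
      (∀ a, k a ≠ 0 → ∃ e, (k a + 1) • (some a : Option E) = some e) ∧
        ∃ s, IsAtomicSum k s ∧ oplus v.1 s = some x := by
  constructor
  · rintro ⟨hk, hord, t, s, ht, hs, hx⟩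
    refine ⟨fun a ha => ?_, s, (hasBigSum_iff_isAtomicSum hk ht).1 hs, hx⟩
    have h1 := ht ⟨a, ha⟩
    rw [mult_eq_nsmul] at h1
    exact Option.ne_none_iff_exists'.1 fun h => hord a ha ((hasOrd_iff h1).2 h)
  · rintro ⟨hk, s, hs, hx⟩
    have h1 : ∀ a : {a : E // k a ≠ 0}, ∃ c, mult (k a.1) a.1 = some c := by
      intro a
      obtain ⟨c, hc, -⟩ := hs.below_nsmul a.1
      exact ⟨c, (mult_eq_nsmul _ _).trans hc⟩
    choose t ht using h1
    refine ⟨hs.isAtom, fun a ha h => ?_, t, s, ht,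
      (hasBigSum_iff_isAtomicSum hs.isAtom ht).2 hs, hx⟩
    obtain ⟨e, he⟩ := hk a ha
    have h2 := ht ⟨a, ha⟩
    rw [mult_eq_nsmul] at h2
    rw [(hasOrd_iff h2).1 h] at he
    cases he

theorem isBasicDecomposition_zero (v : sharp E) : IsBasicDecomposition v.1 v 0 := by
  refine isBasicDecomposition_iff.2 ⟨fun a ha => absurd rfl ha, 0, ⟨fun a ha => absurd rfl ha,
    fun f hf => ?_, fun u _ => bot_le⟩, oplus_zero _⟩
  have : f = 0 := Finsupp.ext fun a => Nat.le_zero.1 (hf a)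
  rw [this, map_zero, option_zero_eq, below_some]

/-- Every sum of multiples of atoms refines a basic decomposition. -/
theorem IsAtomicSum.exists_isBasicDecomposition (hS : IsSharplyDominating E) {h : E → ℕ} {x : E}
    (hx : IsAtomicSum h x) : ∃ (v : sharp E) (k l : E → ℕ), h = l + k ∧
      IsBasicDecomposition x v k ∧ IsAtomicSum l v.1 ∧
      ∀ a, l a ≠ 0 → (l a + 1) • (some a : Option E) = none := by
  classical
  obtain ⟨v, hv⟩ := exists_isGreatest_sharp hS x
  obtain ⟨m, hm⟩ := (le_iff _ _).1 hv.1.2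
  -- `l` keeps the multiplicities equal to the order of the atom, `k` all the others.
  let k : E → ℕ := fun a => if (h a + 1) • (some a : Option E) = none then 0 else h a
  let l : E → ℕ := fun a => if (h a + 1) • (some a : Option E) = none then h a else 0
  have hlk : h = l + k := by
    funext a
    simp only [Pi.add_apply, k, l]
    split_ifs <;> simp
  have hl : ∀ a, l a ≠ 0 → k a = 0 ∧ (l a + 1) • (some a : Option E) = none := by
    intro a ha
    simp only [l, k] at ha ⊢
    split_ifs at ha ⊢ with h1
    · exact ⟨rfl, h1⟩
    · exact absurd rfl ha
  have hk : ∀ a, k a ≠ 0 → l a = 0 ∧ ∃ e, (k a + 1) • (some a : Option E) = some e := by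
    intro a ha
    simp only [l, k] at ha ⊢
    split_ifs at ha ⊢ with h1
    · exact absurd rfl ha
    · exact ⟨rfl, Option.ne_none_iff_exists'.1 h1⟩
  obtain ⟨h1, h2⟩ := (hlk ▸ hx).split hv hm hl hk
  exact ⟨⟨v, hv.1.1⟩, k, l, hlk,
    isBasicDecomposition_iff.2 ⟨fun a ha => (hk a ha).2, m, h2, hm⟩, h1, fun a ha => (hl a ha).2⟩

/-- The sharp part must be the greatest sharp element `g ≤ x`: the difference of `g` and `v` is
sharp and lies below an atomic sum without maximal multiplicities, so it vanishes. Cancelling `v`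
leaves the uniqueness of such sums. -/
theorem IsBasicDecomposition.unique [IsAtomic E] (hS : IsSharplyDominating E) {x : E}
    {v w : sharp E} {k l : E → ℕ} (hv : IsBasicDecomposition x v k)
    (hw : IsBasicDecomposition x w l) : v = w ∧ k = l := by
  obtain ⟨g, hg⟩ := exists_isGreatest_sharp hS x
  have key : ∀ {v : sharp E} {k : E → ℕ}, IsBasicDecomposition x v k → v.1 = g := by
    intro v k h
    obtain ⟨hk, s, hs, hx⟩ := isBasicDecomposition_iff.1 h
    obtain ⟨d, hd⟩ := (le_iff _ _).1 (hg.2 ⟨v.2, le_of_oplus hx⟩)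
    have hd0 : d = 0 := hs.eq_zero_of_sharp hk (sharp_of_oplus v.2 hg.1.1 hd)
      (le_of_oplus_le_oplus hd hx hg.1.2)
    rw [hd0, oplus_zero, Option.some.injEq] at hd
    exact hd
  have hvw : v = w := Subtype.ext ((key hv).trans (key hw).symm)
  subst hvw
  obtain ⟨hk, s, hs, hx⟩ := isBasicDecomposition_iff.1 hv
  obtain ⟨hl, t, ht, hx'⟩ := isBasicDecomposition_iff.1 hw
  rw [oplus_left_cancel hx' hx] at ht
  exact ⟨rfl, hs.unique ht hk hl⟩

theorem existsUnique_isBasicDecomposition [IsAtomic E] (hA : IsArchimedean E)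
    (hS : IsSharplyDominating E) (x : E) :
    ∃! d : sharp E × (E → ℕ), IsBasicDecomposition x d.1 d.2 := by
  obtain ⟨h, hx⟩ := exists_isAtomicSum hA x
  obtain ⟨v, k, -, -, hk, -⟩ := hx.exists_isBasicDecomposition hS
  refine ⟨(v, k), hk, fun d hd => ?_⟩
  obtain ⟨h1, h2⟩ := hd.unique hS hk
  exact Prod.ext h1 h2

/-! ### Evaluating the state on atomic sums -/

/-- `N a` is the order of each atom `a`, and `W a = N a · a`. -/
def IsAtomTop (N : E → ℕ) (W : E → sharp E) : Prop :=
  ∀ a, IsAtom a → 0 < N a ∧ N a • (some a : Option E) = some (W a : E) ∧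
    (N a + 1) • (some a : Option E) = none

theorem exists_isAtomTop (hA : IsArchimedean E) :
    ∃ (N : E → ℕ) (W : E → sharp E), IsAtomTop N W := by
  have h : ∀ a : E, ∃ (n : ℕ) (w : sharp E), IsAtom a → 0 < n ∧
      n • (some a : Option E) = some (w : E) ∧ (n + 1) • (some a : Option E) = none := by
    intro a
    by_cases ha : IsAtom a
    · obtain ⟨n, hn, ⟨w, hw⟩, hn'⟩ := exists_nsmul_eq_none hA ha.1
      exact ⟨n, ⟨w, mem_sharp_of_nsmul_eq_none ha hw hn'⟩, fun _ => ⟨hn, hw, hn'⟩⟩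
    · exact ⟨0, 0, fun h => absurd h ha⟩
  choose N W h using h
  exact ⟨N, W, h⟩

theorem IsAtomicSum.le_atomTop {N : E → ℕ} {W : E → sharp E} (hN : IsAtomTop N W) {k : E → ℕ}
    {x : E} (h : IsAtomicSum k x) (a : E) : k a ≤ N a := by
  by_cases ha : k a = 0
  · rw [ha]; exact Nat.zero_le _
  · obtain ⟨c, hc, -⟩ := h.below_nsmul a
    exact nsmul_le_of_eq_none (hN a (h.isAtom a ha)).2.2 hc

theorem IsState.map_zero {F : Type u} [EffectAlgebra F] {ω : F → ℝ} (hω : IsState ω) :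
    ω 0 = 0 := by
  have := hω.map_oplus 0 0 0 (oplus_zero 0)
  linarith

theorem IsState.map_msum_restr {ω : sharp E → ℝ} (hω : IsState ω) {N : E → ℕ} {W : E → sharp E}
    (hN : IsAtomTop N W) {k : E → ℕ} (F : Finset E)
    (hk : ∀ a ∈ F, k a ≠ 0 → IsAtom a ∧ k a = N a) :
    ∀ c : sharp E, msum (restr k F) = some (c : E) →
      ω c = ∑ a ∈ F, (k a : ℝ) * (ω (W a) / N a) := by
  classical
  induction F using Finset.induction_on with
  | empty =>
    intro c hc
    rw [msum_restr, Finset.sum_empty, option_zero_eq, Option.some.injEq] at hc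
    have : c = 0 := Subtype.ext hc.symm
    rw [this, hω.map_zero, Finset.sum_empty]
  | insert a F ha ih =>
    intro c hc
    have hk' : ∀ b ∈ F, k b ≠ 0 → IsAtom b ∧ k b = N b :=
      fun b hb => hk b (Finset.mem_insert_of_mem hb)
    rw [msum_restr, Finset.sum_insert ha, ← msum_restr] at hc
    obtain ⟨d, e, hd, he, hde⟩ := add_eq_some_iff.1 hc
    have hes : e ∈ sharp E := msum_restr_mem_sharp F (fun b hb h0 => by
      obtain ⟨h1, h2⟩ := hk' b hb h0
      exact ⟨h1, h2 ▸ (hN b h1).2.2⟩) e he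
    rw [Finset.sum_insert ha, ← ih hk' ⟨e, hes⟩ he]
    by_cases h0 : k a = 0
    · rw [h0, zero_nsmul, option_zero_eq, Option.some.injEq] at hd
      rw [← hd, zero_oplus, Option.some.injEq] at hde
      have : c = ⟨e, hes⟩ := Subtype.ext hde.symm
      rw [this, h0, Nat.cast_zero, zero_mul, zero_add]
    · obtain ⟨h1, h2⟩ := hk a (Finset.mem_insert_self a F) h0
      obtain ⟨h3, h4, -⟩ := hN a h1
      rw [h2, h4, Option.some.injEq] at hd
      rw [hω.map_oplus (W a) ⟨e, hes⟩ c (sharpOplus_eq_some.2 (hd ▸ hde)), h2, mul_div_cancel₀]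
      exact Nat.cast_ne_zero.2 h3.ne'

/-- This is where order-continuity enters. The finite sums are sharp and increase to `v` along the
directed set `Finset E`; a supremum in `E` that is sharp is also the supremum in `S(E)`. -/
theorem hasSum_of_isAtomicSum_sharp {ω : sharp E → ℝ} (hω : IsState ω) (hc : IsOrderContinuous ω)
    {N : E → ℕ} {W : E → sharp E} (hN : IsAtomTop N W) {k : E → ℕ} {v : sharp E}
    (hv : IsAtomicSum k v.1) (hk : ∀ a, k a ≠ 0 → (k a + 1) • (some a : Option E) = none) :
    HasSum (fun a => (k a : ℝ) * (ω (W a) / N a)) (ω v) := by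
  classical
  have hsum : ∀ F : Finset E, ∃ c : sharp E, msum (restr k F) = some c.1 ∧ c ≤ v := by
    intro F
    obtain ⟨c, hc, hcv⟩ := hv.below _ (restr_le k F)
    exact ⟨⟨c, msum_restr_mem_sharp F (fun a _ ha => ⟨hv.isAtom a ha, hk a ha⟩) c hc⟩, hc, hcv⟩
  choose c hcF hcv using hsum
  have hconv : OrderConverges c v := by
    refine ⟨c, fun _ => v, fun F G hFG => ?_, ⟨?_, fun u hu => ?_⟩, antitone_const, ?_,
      fun F => ⟨le_rfl, hcv F⟩⟩
    · have : Below (msum (restr k G)) (c G).1 := ⟨_, hcF G, le_rfl⟩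
      have := this.msum_mono (restr_mono k hFG)
      rwa [hcF F, below_some] at this
    · rintro _ ⟨F, rfl⟩
      exact hcv F
    · refine hv.le u.1 fun f hf => ?_
      have : Below (msum (restr k f.support)) u.1 := ⟨_, hcF _, hu ⟨_, rfl⟩⟩
      exact this.msum_mono (le_restr hf subset_rfl)
    · rw [Set.range_const]
      exact isGLB_singleton
  have hlim := hc (Finset E) c v hconv
  have hval : (fun F => ω (c F)) = fun F => ∑ a ∈ F, (k a : ℝ) * (ω (W a) / N a) := by
    funext F
    refine hω.map_msum_restr hN F (fun a _ ha => ⟨hv.isAtom a ha, ?_⟩) _ (hcF F)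
    obtain ⟨-, h1, -⟩ := hN a (hv.isAtom a ha)
    exact le_antisymm (hv.le_atomTop hN a) (nsmul_le_of_eq_none (hk a ha) h1)
  rw [hval] at hlim
  simpa [HasSum] using hlim

/-- Pairwise orthogonality of distinct atoms, which involves one copy of each, already makes their
maximal multiples jointly summable. -/
theorem exists_msum_restr_eq_some {N : E → ℕ} {W : E → sharp E} (hN : IsAtomTop N W)
    (F : Finset E) (hF : ∀ a ∈ F, IsAtom a) (horth : ∀ a ∈ F, ∀ b ∈ F, a ≠ b → a ≤ orth b) :
    ∃ c, msum (restr N F) = some c := by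
  classical
  induction F using Finset.induction_on with
  | empty => exact ⟨0, by rw [msum_restr, Finset.sum_empty]; rfl⟩
  | insert b F hb ih =>
    obtain ⟨c, hc⟩ := ih (fun a ha => hF a (Finset.mem_insert_of_mem ha)) fun a ha d hd =>
      horth a (Finset.mem_insert_of_mem ha) d (Finset.mem_insert_of_mem hd)
    have hbF := Finset.mem_insert_self b F
    obtain ⟨h0, h1⟩ := disjoint_orth_msum (z := b) (restr N F) (fun a ha => by
      have haF : a ∈ F := by
        by_contra h
        exact Finsupp.mem_support_iff.1 ha (restr_apply_of_notMem N h)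
      have hba : b ≠ a := fun h => hb (h ▸ haF)
      have haF := Finset.mem_insert_of_mem (b := b) haF
      exact ⟨inf_eq_zero_of_isAtom_of_ne (hF b hbF) (hF a haF) hba, horth b hbF a haF hba⟩) c hc
    have hW := (hN b (hF b hbF)).2.1
    have h2 := (disjoint_orth_nsmul (by rwa [inf_comm] at h0) (le_orth_comm.1 h1) (N b) _ hW).2
    obtain ⟨d, hd⟩ := le_orth_iff.1 (le_orth_comm.1 h2)
    exact ⟨d, by rw [msum_restr, Finset.sum_insert hb, ← msum_restr, hc, hW, some_add_some, hd]⟩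

/-- Raising each nonzero multiplicity in a finite sum to the order of its atom gives a sharp
element, whose state is at most 1; this bounds all partial sums. -/
theorem IsAtomicSum.summable {ω : sharp E → ℝ} (hω : IsState ω) {N : E → ℕ} {W : E → sharp E}
    (hN : IsAtomTop N W) {k : E → ℕ} {x : E} (hx : IsAtomicSum k x) :
    Summable fun a => (k a : ℝ) * (ω (W a) / N a) := by
  classical
  have hp : ∀ a, 0 ≤ ω (W a) / N a := fun a => div_nonneg (hω.mem_Icc _).1 (Nat.cast_nonneg _)
  refine summable_of_sum_le (c := 1) (fun a => mul_nonneg (Nat.cast_nonneg _) (hp a)) fun F => ?_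
  have hatom : ∀ a ∈ F.filter (k · ≠ 0), IsAtom a :=
    fun a ha => hx.isAtom a (Finset.mem_filter.1 ha).2
  obtain ⟨c, hc⟩ := exists_msum_restr_eq_some hN (F.filter (k · ≠ 0)) hatom fun a ha b hb =>
    hx.le_orth_of_ne (Finset.mem_filter.1 ha).2 (Finset.mem_filter.1 hb).2
  have hcs : c ∈ sharp E := msum_restr_mem_sharp _
    (fun a ha _ => ⟨hatom a ha, (hN a (hatom a ha)).2.2⟩) c hc
  calc ∑ a ∈ F, (k a : ℝ) * (ω (W a) / N a)
      = ∑ a ∈ F.filter (k · ≠ 0), (k a : ℝ) * (ω (W a) / N a) := by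
        refine (Finset.sum_filter_of_ne (p := fun a => k a ≠ 0) fun a _ ha h0 => ha ?_).symm
        rw [h0, Nat.cast_zero, zero_mul]
    _ ≤ ∑ a ∈ F.filter (k · ≠ 0), (N a : ℝ) * (ω (W a) / N a) :=
        Finset.sum_le_sum fun a _ =>
          mul_le_mul_of_nonneg_right (Nat.cast_le.2 (hx.le_atomTop hN a)) (hp a)
    _ = ω ⟨c, hcs⟩ :=
        (hω.map_msum_restr hN _ (fun a ha _ => ⟨hatom a ha, rfl⟩) ⟨c, hcs⟩ hc).symm
    _ ≤ 1 := (hω.mem_Icc _).2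

/-- The smearing of a function on `S(E)`: its value at `x` is computed from the basic
decomposition of `x`. -/
theorem exists_smearing [IsAtomic E] (hA : IsArchimedean E) (hS : IsSharplyDominating E)
    (ω : sharp E → ℝ) (N : E → ℕ) (W : E → sharp E) :
    ∃ ω' : E → ℝ, ∀ x v k, IsBasicDecomposition x v k →
      ω' x = ω v + ∑' a, (k a : ℝ) * (ω (W a) / N a) := by
  choose d hd using fun x => (existsUnique_isBasicDecomposition hA hS x).exists
  refine ⟨fun x => ω (d x).1 + ∑' a, ((d x).2 a : ℝ) * (ω (W a) / N a), fun x v k h => ?_⟩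
  obtain ⟨h1, h2⟩ := (hd x).unique hS h
  simp only [h1, h2]

/-- The value can be computed from any representation by atoms, not only from the basic
decomposition: the maximal multiplicities contribute exactly `ω v`. -/
theorem hasSum_smearing (hS : IsSharplyDominating E) {ω : sharp E → ℝ} (hω : IsState ω)
    (hc : IsOrderContinuous ω) {N : E → ℕ} {W : E → sharp E} (hN : IsAtomTop N W) {ω' : E → ℝ}
    (hω' : ∀ x v k, IsBasicDecomposition x v k →
      ω' x = ω v + ∑' a, (k a : ℝ) * (ω (W a) / N a)) {h : E → ℕ} {x : E}
    (hx : IsAtomicSum h x) : HasSum (fun a => (h a : ℝ) * (ω (W a) / N a)) (ω' x) := by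
  obtain ⟨v, k, l, rfl, hk, hl, hl'⟩ := hx.exists_isBasicDecomposition hS
  rw [hω' x v k hk]
  obtain ⟨-, s, hs, -⟩ := isBasicDecomposition_iff.1 hk
  simpa [add_mul] using
    (hasSum_of_isAtomicSum_sharp hω hc hN hl hl').add (hs.summable hω hN).hasSum

end EffectAlgebra

/-! ### The state smearing theorem -/

open EffectAlgebra in
theorem theorem4p2 {E : Type u} [LatticeEffectAlgebra E] [IsAtomic E]
    (hA : IsArchimedean E) (hS : IsSharplyDominating E)
    (ω : sharp E → ℝ) (hω : IsState ω) (hc : IsOrderContinuous ω) :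
    -- basic decompositions exist and are unique
    (∀ x : E, ∃! d : sharp E × (E → ℕ), IsBasicDecomposition x d.1 d.2) ∧
    ∃ ω' : E → ℝ, IsState ω' ∧
      -- `ω'` extends `ω`
      (∀ x : sharp E, ω' x = ω x) ∧
      -- for every atom `a`, the element `n_a a` is sharp and `ω' a = ω (n_a a) / n_a`
      (∀ a : E, IsAtom a → ∃ (n : ℕ) (w : sharp E), 0 < n ∧ HasOrd a n ∧
        mult n a = some (w : E) ∧ ω' a = ω w / n) ∧
      -- the value of `ω'` at `x` in terms of the basic decomposition of `x`
      (∀ (x : E) (v : sharp E) (k : E → ℕ), IsBasicDecomposition x v k →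
        ∃ r : ℝ, IsLUB (Set.range fun K : Finset {a : E // k a ≠ 0} =>
            ∑ a ∈ K, (k a : ℝ) * ω' a) r ∧
          ω' x = ω v + r) := by
  obtain ⟨N, W, hN⟩ := exists_isAtomTop hA
  obtain ⟨ω', hω'⟩ := exists_smearing hA hS ω N W
  have hsum : ∀ {h : E → ℕ} {x : E}, IsAtomicSum h x →
      HasSum (fun a => (h a : ℝ) * (ω (W a) / N a)) (ω' x) :=
    fun hx => hasSum_smearing hS hω hc hN hω' hx
  have hp : ∀ a, 0 ≤ ω (W a) / N a := fun a => div_nonneg (hω.mem_Icc _).1 (Nat.cast_nonneg _)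
  have hnonneg : ∀ x, 0 ≤ ω' x := fun x => by
    obtain ⟨h, hx⟩ := exists_isAtomicSum hA x
    exact (hsum hx).nonneg fun a => mul_nonneg (Nat.cast_nonneg _) (hp a)
  have hsharp : ∀ x : sharp E, ω' x = ω x := fun x => by
    rw [hω' _ _ _ (isBasicDecomposition_zero x)]
    simp
  have hone : ω' 1 = 1 := (hsharp 1).trans hω.map_one
  have hadd : ∀ x y z, oplus x y = some z → ω' z = ω' x + ω' y := by
    intro x y z h
    obtain ⟨k, hk⟩ := exists_isAtomicSum hA x
    obtain ⟨l, hl⟩ := exists_isAtomicSum hA y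
    -- In `k + l` some multiplicities may become maximal and move into the sharp part of `z`; the
    -- value is unaffected, since any representation computes it.
    refine (hsum (hk.add hl h)).unique ?_
    simpa [add_mul] using (hsum hk).add (hsum hl)
  have hatom : ∀ a, IsAtom a → ω' a = ω (W a) / N a := by
    classical
    intro a ha
    refine (hsum (isAtomicSum_single ha)).unique ?_
    convert hasSum_single a _ using 1
    · simp
    · intro b hb
      simp [Finsupp.single_eq_of_ne hb]
  refine ⟨existsUnique_isBasicDecomposition hA hS, ω', ⟨fun x => ⟨hnonneg x, ?_⟩, hone, hadd⟩,
    hsharp, fun a ha => ?_, fun x v k hk => ?_⟩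
  -- The upper bound follows from `ω' x + ω' (orth x) = 1` and nonnegativity.
  · have := hadd x _ 1 (oplus_orth x)
    have := hnonneg (orth x)
    linarith
  · obtain ⟨h1, h2, h3⟩ := hN a ha
    exact ⟨N a, W a, h1, (hasOrd_iff h2).2 h3, (mult_eq_nsmul _ _).trans h2, hatom a ha⟩
  · refine ⟨_, ?_, hω' x v k hk⟩
    obtain ⟨-, s, hs, -⟩ := isBasicDecomposition_iff.1 hk
    have h1 : HasSum (fun a : {a : E // k a ≠ 0} => (k a : ℝ) * ω' a)
        (∑' a, (k a : ℝ) * (ω (W a) / N a)) := by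
      have h2 := (hasSum_subtype_iff_of_support_subset (s := {a | k a ≠ 0}) fun a ha h0 => ha (by
        rw [h0, Nat.cast_zero, zero_mul])).2 (hs.summable hω hN).hasSum
      have h3 : (fun a : {a : E // k a ≠ 0} => (k a : ℝ) * ω' a) =
          (fun a => (k a : ℝ) * (ω (W a) / N a)) ∘ Subtype.val :=
        funext fun a => by rw [hatom _ (hs.isAtom a.1 a.2)]; rfl
      rw [h3]
      exact h2
    exact isLUB_hasSum (fun a => mul_nonneg (Nat.cast_nonneg _) (hnonneg _)) h1
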